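/- Let $\mathbb{G}=(A,\Delta)$ be a compact quantum group: $A$ is a unital $C^*$-algebra and $\Delta:A\to A\otimes A$ (minimal tensor product) is a unital $*$-homomorphism with $(\Delta\otimes\iota)\Delta=(\iota\otimes\Delta)\Delta$ and $[\Delta(A)(A\otimes 1)]=A\otimes A=[\Delta(A)(1\otimes A)]$, where $[\,\cdot\,]$ denotes the closed linear span. Assume that the Haar state $h$ of $\mathbb{G}$ (the state with $(h\otimes\iota)\Delta(a)=h(a)1=(\iota\otimes h)\Delta(a)$ for all $a\in A$) is faithful. A $\mathbb{G}$-$C^*$-algebra is a (not necessarily unital) $C^*$-algebra $D$ with a coaction, that is, a $*$-homomorphism $\Delta_D:D\to A\otimes D$ such that $(\iota\otimes\Delta_D)\Delta_D=(\Delta\otimes\iota)\Delta_D$ and $[\Delta_D(D)(A\otimes 1)]=A\otimes D$. A $\mathbb{G}$-morphism from $D$ to a $\mathbb{G}$-$C^*$-algebra $B$ is a $*$-homomorphism $\pi:D\to M(B)$ into the multiplier algebra which is nondegenerate, $[\pi(D)B]=B$, and equivariant, $\Delta_B\circ\pi=(\iota\otimes\pi)\circ\Delta_D$, where $\Delta_B$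 is extended to $M(B)$. One calls $D$ $\mathbb{G}$-simple if $\ker\pi=\{0\}$ for every nonzero $\mathbb{G}$-$C^*$-algebra $B$ and every $\mathbb{G}$-morphism $\pi$ from $D$ to $B$. Let $X$ be a unital $\mathbb{G}$-$C^*$-algebra that is a quantum homogeneous space, i.e. its coaction is ergodic: $\{x\in X:\Delta_X(x)=1\otimes x\}=\mathbb{C}1$. If $\Delta_X$ is injective, then $X$ is $\mathbb{G}$-simple. -/

import Mathlib

open scoped ComplexOrder TensorProduct MultiplierAlgebra

universe u v w v' w'

noncomputable section

namespace QuantumGroup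

/-! ### Hilbert space tensor products -/

section HilbertTensor

variable (H : Type u) (K : Type u)
  [NormedAddCommGroup H] [InnerProductSpace ℂ H] [NormedAddCommGroup K] [InnerProductSpace ℂ K]

/-- The Hilbert space tensor product of `H` and `K`. -/
abbrev HilbertTensor : Type u := UniformSpace.Completion (H ⊗[ℂ] K)

variable {H K}

/-- The elementary tensor `ξ ⊗ η` of vectors. -/
def vecTmul (ξ : H) (η : K) : HilbertTensor H K := ((ξ ⊗ₜ[ℂ] η : H ⊗[ℂ] K) : HilbertTensor H K)

/-- The operator `S ⊗ T` on the Hilbert space tensor product. -/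
def opTensor (S : H →L[ℂ] H) (T : K →L[ℂ] K) : HilbertTensor H K →L[ℂ] HilbertTensor H K :=
  (TensorProduct.mapL S T).completion

theorem opTensor_coe (S : H →L[ℂ] H) (T : K →L[ℂ] K) (x : H ⊗[ℂ] K) :
    opTensor S T (x : HilbertTensor H K) = (TensorProduct.mapL S T x : H ⊗[ℂ] K) :=
  ContinuousLinearMap.completion_apply_coe _ _

theorem clm_ext_coe {f g : HilbertTensor H K →L[ℂ] HilbertTensor H K}
    (h : ∀ x : H ⊗[ℂ] K, f x = g x) : f = g := by
  ext z
  induction z using UniformSpace.Completion.induction_on with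
  | hp => exact isClosed_eq f.continuous g.continuous
  | ih x => exact h x

theorem opTensor_add_left (S S' : H →L[ℂ] H) (T : K →L[ℂ] K) :
    opTensor (S + S') T = opTensor S T + opTensor S' T :=
  clm_ext_coe fun x => by
    simp only [add_apply, opTensor_coe, TensorProduct.mapL_add_left,
      UniformSpace.Completion.coe_add]

theorem opTensor_add_right (S : H →L[ℂ] H) (T T' : K →L[ℂ] K) :
    opTensor S (T + T') = opTensor S T + opTensor S T' :=
  clm_ext_coe fun x => by
    simp only [add_apply, opTensor_coe, TensorProduct.mapL_add_right,
      UniformSpace.Completion.coe_add]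

theorem opTensor_smul_left (c : ℂ) (S : H →L[ℂ] H) (T : K →L[ℂ] K) :
    opTensor (c • S) T = c • opTensor S T :=
  clm_ext_coe fun x => by
    simp only [smul_apply, opTensor_coe, TensorProduct.mapL_smul_left,
      UniformSpace.Completion.coe_smul]

theorem opTensor_smul_right (c : ℂ) (S : H →L[ℂ] H) (T : K →L[ℂ] K) :
    opTensor S (c • T) = c • opTensor S T :=
  clm_ext_coe fun x => by
    simp only [smul_apply, opTensor_coe, TensorProduct.mapL_smul_right,
      UniformSpace.Completion.coe_smul]

theorem opTensor_mul (S S' : H →L[ℂ] H) (T T' : K →L[ℂ] K) :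
    opTensor (S * S') (T * T') = opTensor S T * opTensor S' T' :=
  clm_ext_coe fun x => by
    simp only [mul_apply_eq_comp, opTensor_coe, TensorProduct.mapL_mul]

theorem opTensor_star [CompleteSpace H] [CompleteSpace K] (S : H →L[ℂ] H) (T : K →L[ℂ] K) :
    star (opTensor S T) = opTensor (star S) (star T) := by
  rw [ContinuousLinearMap.star_eq_adjoint, eq_comm, ContinuousLinearMap.eq_adjoint_iff]
  intro x y
  induction x, y using UniformSpace.Completion.induction_on₂ with
  | hp => apply isClosed_eq <;> fun_prop
  | ih x y =>
    rw [opTensor_coe, opTensor_coe, UniformSpace.Completion.inner_coe,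
      UniformSpace.Completion.inner_coe]
    induction x with
    | zero => simp
    | add x x' hx hx' => simp only [map_add, inner_add_left, hx, hx']
    | tmul a b =>
      induction y with
      | zero => simp
      | add y y' hy hy' => simp only [map_add, inner_add_right, hy, hy']
      | tmul c d =>
        simp only [TensorProduct.mapL_tmul, TensorProduct.inner_tmul,
          ContinuousLinearMap.star_eq_adjoint, ContinuousLinearMap.adjoint_inner_left]

theorem norm_opTensor_le (S : H →L[ℂ] H) (T : K →L[ℂ] K) : ‖opTensor S T‖ ≤ ‖S‖ * ‖T‖ := by
  refine ContinuousLinearMap.opNorm_le_bound _ (by positivity) fun z => ?_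
  induction z using UniformSpace.Completion.induction_on with
  | hp => exact isClosed_le (by fun_prop) (by fun_prop)
  | ih x =>
    rw [opTensor_coe, UniformSpace.Completion.norm_coe, UniformSpace.Completion.norm_coe]
    exact (ContinuousLinearMap.le_opNorm _ _).trans
      (mul_le_mul_of_nonneg_right (TensorProduct.norm_mapL_le S T) (norm_nonneg _))

end HilbertTensor

/-! ### Representations -/

/-- A (possibly degenerate) representation of a C⋆-algebra on a Hilbert space. -/
structure HilbertRep (A : Type v) [NonUnitalCStarAlgebra A] : Type (max v (u + 1)) where
  space : Type u
  [normedAddCommGroup : NormedAddCommGroup space]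
  [innerProductSpace : InnerProductSpace ℂ space]
  [completeSpace : CompleteSpace space]
  hom : A →⋆ₙₐ[ℂ] (space →L[ℂ] space)

attribute [instance] HilbertRep.normedAddCommGroup HilbertRep.innerProductSpace
  HilbertRep.completeSpace

/-- The pull-back of a representation along a ⋆-homomorphism. -/
abbrev HilbertRep.comp {A : Type v} {B : Type w} [NonUnitalCStarAlgebra A] [NonUnitalCStarAlgebra B]
    (π : HilbertRep.{u} B) (f : A →⋆ₙₐ[ℂ] B) : HilbertRep.{u} A where
  space := π.space
  hom := π.hom.comp f

/-! ### The minimal tensor product -/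

section MinTensor

variable (A : Type v) (B : Type w) [NonUnitalCStarAlgebra A] [NonUnitalCStarAlgebra B]

variable {A B} in
/-- The C⋆-algebra `B(H_π ⊗ K_ρ)` attached to a pair `(π, ρ)` of representations. -/
def OpAlg (i : HilbertRep.{u} A × HilbertRep.{u} B) : Type u :=
  HilbertTensor i.1.space i.2.space →L[ℂ] HilbertTensor i.1.space i.2.space

instance (i : HilbertRep.{u} A × HilbertRep.{u} B) : CStarAlgebra (OpAlg i) :=
  inferInstanceAs (CStarAlgebra
    (HilbertTensor i.1.space i.2.space →L[ℂ] HilbertTensor i.1.space i.2.space))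

/-- The C⋆-algebra `∏ B(H_π ⊗ K_ρ)` of bounded families of operators, indexed by all pairs of
representations `π` of `A` and `ρ` of `B`. -/
abbrev Ambient : Type (max v w (u + 1)) :=
  lp (fun i : HilbertRep.{u} A × HilbertRep.{u} B => OpAlg i) ⊤

variable {A B}

theorem memℓp_of_le {E : HilbertRep.{u} A × HilbertRep.{u} B → Type*}
    [∀ i, NormedAddCommGroup (E i)] (f : ∀ i, E i) (C : ℝ) (h : ∀ i, ‖f i‖ ≤ C) :
    Memℓp f ⊤ :=
  memℓp_infty ⟨C, by rintro _ ⟨i, rfl⟩; exact h i⟩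

/-- The family `(π(a) ⊗ ρ(b))` representing the elementary tensor `a ⊗ b`. -/
def ambientTmul (a : A) (b : B) : Ambient.{u} A B :=
  ⟨fun i => opTensor (i.1.hom a) (i.2.hom b), memℓp_of_le _ (‖a‖ * ‖b‖) fun i =>
    (norm_opTensor_le _ _).trans (mul_le_mul (NonUnitalStarAlgHom.norm_apply_le i.1.hom a)
      (NonUnitalStarAlgHom.norm_apply_le i.2.hom b) (norm_nonneg _) (norm_nonneg _))⟩

/-- The family `(π(a) ⊗ 1)` representing the multiplier `a ⊗ 1`. -/
def leftLeg (a : A) : Ambient.{u} A B :=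
  ⟨fun i => opTensor (i.1.hom a) 1, memℓp_of_le _ ‖a‖ fun i =>
    ((norm_opTensor_le _ _).trans (mul_le_mul (NonUnitalStarAlgHom.norm_apply_le i.1.hom a)
      ContinuousLinearMap.norm_id_le (norm_nonneg _) (norm_nonneg _))).trans_eq (mul_one _)⟩

/-- The family `(1 ⊗ ρ(b))` representing the multiplier `1 ⊗ b`. -/
def rightLeg (b : B) : Ambient.{u} A B :=
  ⟨fun i => opTensor 1 (i.2.hom b), memℓp_of_le _ ‖b‖ fun i =>
    ((norm_opTensor_le _ _).trans (mul_le_mul ContinuousLinearMap.norm_id_le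
      (NonUnitalStarAlgHom.norm_apply_le i.2.hom b) (norm_nonneg _)
        zero_le_one)).trans_eq (one_mul _)⟩

theorem ambient_ext {s t : Ambient.{u} A B} (h : ∀ i, s.1 i = t.1 i) : s = t :=
  Subtype.ext (funext h)

theorem ambientTmul_mul (a c : A) (b d : B) :
    ambientTmul.{u} a b * ambientTmul c d = ambientTmul (a * c) (b * d) :=
  ambient_ext fun i => by
    change opTensor (i.1.hom a) (i.2.hom b) * opTensor (i.1.hom c) (i.2.hom d) =
      opTensor (i.1.hom (a * c)) (i.2.hom (b * d))
    rw [map_mul, map_mul, opTensor_mul]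

theorem ambientTmul_star (a : A) (b : B) :
    star (ambientTmul.{u} a b) = ambientTmul (star a) (star b) :=
  ambient_ext fun i => by
    change star (opTensor (i.1.hom a) (i.2.hom b)) = opTensor (i.1.hom (star a)) (i.2.hom (star b))
    rw [map_star, map_star, opTensor_star]

theorem ambientTmul_add_left (a a' : A) (b : B) :
    ambientTmul.{u} (a + a') b = ambientTmul a b + ambientTmul a' b :=
  ambient_ext fun i => by
    change opTensor (i.1.hom (a + a')) (i.2.hom b) =
      opTensor (i.1.hom a) (i.2.hom b) + opTensor (i.1.hom a') (i.2.hom b)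
    rw [map_add, opTensor_add_left]

theorem ambientTmul_add_right (a : A) (b b' : B) :
    ambientTmul.{u} a (b + b') = ambientTmul a b + ambientTmul a b' :=
  ambient_ext fun i => by
    change opTensor (i.1.hom a) (i.2.hom (b + b')) =
      opTensor (i.1.hom a) (i.2.hom b) + opTensor (i.1.hom a) (i.2.hom b')
    rw [map_add, opTensor_add_right]

theorem ambientTmul_smul_left (c : ℂ) (a : A) (b : B) :
    ambientTmul.{u} (c • a) b = c • ambientTmul a b :=
  ambient_ext fun i => by
    change opTensor (i.1.hom (c • a)) (i.2.hom b) = c • opTensor (i.1.hom a) (i.2.hom b)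
    rw [map_smul, opTensor_smul_left]

theorem ambientTmul_smul_right (c : ℂ) (a : A) (b : B) :
    ambientTmul.{u} a (c • b) = c • ambientTmul a b :=
  ambient_ext fun i => by
    change opTensor (i.1.hom a) (i.2.hom (c • b)) = c • opTensor (i.1.hom a) (i.2.hom b)
    rw [map_smul, opTensor_smul_right]

variable (A B)

/-- The algebraic tensor product, as a ⋆-algebra of families of operators. -/
def algTensor : NonUnitalStarSubalgebra ℂ (Ambient.{u} A B) where
  __ := Submodule.span ℂ {t | ∃ a b, t = ambientTmul a b}
  mul_mem' := by
    intro s t hs ht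
    change s * t ∈ Submodule.span ℂ {t | ∃ a b, t = ambientTmul a b}
    refine Submodule.span_induction₂ (p := fun s t _ _ =>
      s * t ∈ Submodule.span ℂ {t | ∃ a b, t = ambientTmul a b}) ?_ ?_ ?_ ?_ ?_ ?_ ?_ hs ht
    · rintro _ _ ⟨a, b, rfl⟩ ⟨c, d, rfl⟩
      refine Submodule.subset_span ⟨a * c, b * d, ambientTmul_mul a c b d⟩
    · intros; simp
    · intros; simp
    · intro x y z _ _ _ h h'; rw [add_mul]; exact add_mem h h'
    · intro x y z _ _ _ h h'; rw [mul_add]; exact add_mem h h'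
    · intro r x y _ _ h; rw [smul_mul_assoc]; exact Submodule.smul_mem _ _ h
    · intro r x y _ _ h; rw [mul_smul_comm]; exact Submodule.smul_mem _ _ h
  star_mem' := by
    intro s hs
    change star s ∈ Submodule.span ℂ {t | ∃ a b, t = ambientTmul a b}
    refine Submodule.span_induction (p := fun s _ =>
      star s ∈ Submodule.span ℂ {t | ∃ a b, t = ambientTmul a b}) ?_ ?_ ?_ ?_ hs
    · rintro _ ⟨a, b, rfl⟩
      refine Submodule.subset_span ⟨star a, star b, ambientTmul_star a b⟩
    · simp
    · intro x y _ _ h h'; rw [star_add]; exact add_mem h h'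
    · intro r x _ h; rw [star_smul]; exact Submodule.smul_mem _ _ h

/-- The minimal (spatial) tensor product `A ⊗ B` of C⋆-algebras: the completion of the algebraic
tensor product in the norm `‖t‖ = sup ‖(π ⊗ ρ)(t)‖`, the supremum being taken over all
representations `π` of `A` and `ρ` of `B`; it is realized as a norm closed ⋆-algebra of families of
operators. -/
def MinTensor : Type (max v w (u + 1)) := ↥((algTensor.{u} A B).topologicalClosure)

instance : NonUnitalCStarAlgebra (MinTensor.{u} A B) :=
  haveI : IsClosed (((algTensor.{u} A B).topologicalClosure : NonUnitalStarSubalgebra ℂ _) :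
    Set (Ambient.{u} A B)) := NonUnitalStarSubalgebra.isClosed_topologicalClosure _
  inferInstanceAs (NonUnitalCStarAlgebra ↥((algTensor.{u} A B).topologicalClosure))

namespace MinTensor

/-- The inclusion of `A ⊗ B` into the algebra of families of operators. -/
def incl : MinTensor.{u} A B →⋆ₙₐ[ℂ] Ambient.{u} A B :=
  NonUnitalStarSubalgebraClass.subtype ((algTensor.{u} A B).topologicalClosure)

variable {A B}

/-- The elementary tensor `a ⊗ b`. -/
def tmul (a : A) (b : B) : MinTensor.{u} A B :=
  ⟨ambientTmul a b, NonUnitalStarSubalgebra.le_topologicalClosure _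
    (Submodule.subset_span ⟨a, b, rfl⟩)⟩

variable (A B) in
/-- The canonical map from the algebraic tensor product to `A ⊗ B`. -/
def ofAlg : A ⊗[ℂ] B →ₗ[ℂ] MinTensor.{u} A B :=
  TensorProduct.lift (LinearMap.mk₂ ℂ tmul
    (fun a a' b => Subtype.ext (ambientTmul_add_left a a' b))
    (fun c a b => Subtype.ext (ambientTmul_smul_left c a b))
    (fun a b b' => Subtype.ext (ambientTmul_add_right a b b'))
    (fun c a b => Subtype.ext (ambientTmul_smul_right c a b)))

/-- The representation `π ⊗ ρ` of `A ⊗ B` on the Hilbert space tensor product. -/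
def tensorRep (π : HilbertRep.{u} A) (ρ : HilbertRep.{u} B) : HilbertRep.{u} (MinTensor.{u} A B) where
  space := HilbertTensor π.space ρ.space
  hom :=
    { toFun := fun t => (incl A B t : ∀ i, _) (π, ρ)
      map_smul' := fun c t => by rw [map_smul]; rfl
      map_zero' := by rw [map_zero]; rfl
      map_add' := fun s t => by rw [map_add]; rfl
      map_mul' := fun s t => by rw [map_mul]; rfl
      map_star' := fun t => by rw [map_star]; rfl }

/-- For bounded `f` on `A`, the slice map `f ⊗ ι : A ⊗ B → B`, i.e. the continuous extension of
`a ⊗ b ↦ f(a) b` (which is bounded by `‖f‖` for the norm of `A ⊗ B`). -/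
def sliceLeft (f : A →L[ℂ] ℂ) : MinTensor.{u} A B →L[ℂ] B :=
  LinearMap.extendOfNorm
    (TensorProduct.lid ℂ B ∘ₗ TensorProduct.map f.toLinearMap (LinearMap.id : B →ₗ[ℂ] B))
    (ofAlg A B)

/-- For bounded `f` on `B`, the slice map `ι ⊗ f : A ⊗ B → A`, i.e. the continuous extension of
`a ⊗ b ↦ f(b) a` (which is bounded by `‖f‖` for the norm of `A ⊗ B`). -/
def sliceRight (f : B →L[ℂ] ℂ) : MinTensor.{u} A B →L[ℂ] A :=
  LinearMap.extendOfNorm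
    (TensorProduct.rid ℂ A ∘ₗ TensorProduct.map (LinearMap.id : A →ₗ[ℂ] A) f.toLinearMap)
    (ofAlg A B)

variable {A' : Type v'} {B' : Type w'} [NonUnitalCStarAlgebra A'] [NonUnitalCStarAlgebra B']

/-- Pulling back families of operators along `f : A → A'` and `g : B → B'`. -/
def ambientMap (f : A →⋆ₙₐ[ℂ] A') (g : B →⋆ₙₐ[ℂ] B') : Ambient.{u} A B →⋆ₙₐ[ℂ] Ambient.{u} A' B' where
  toFun t := ⟨fun i => t.1 (i.1.comp f, i.2.comp g), memℓp_of_le _ ‖t‖ fun _ =>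
    lp.norm_apply_le_norm ENNReal.top_ne_zero t _⟩
  map_smul' _ _ := ambient_ext fun _ => rfl
  map_zero' := ambient_ext fun _ => rfl
  map_add' _ _ := ambient_ext fun _ => rfl
  map_mul' _ _ := ambient_ext fun _ => rfl
  map_star' _ := ambient_ext fun _ => rfl

theorem ambientMap_mem (f : A →⋆ₙₐ[ℂ] A') (g : B →⋆ₙₐ[ℂ] B') {t : Ambient.{u} A B}
    (ht : t ∈ (algTensor.{u} A B).topologicalClosure) :
    ambientMap f g t ∈ (algTensor.{u} A' B').topologicalClosure := by
  have hc : Continuous (ambientMap.{u} f g) :=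
    AddMonoidHomClass.continuous_of_bound _ 1 fun x => by
      simpa using NonUnitalStarAlgHom.norm_apply_le (ambientMap.{u} f g) x
  refine map_mem_closure hc ht fun s hs => ?_
  change ambientMap f g s ∈ Submodule.span ℂ {t | ∃ a b, t = ambientTmul a b}
  refine Submodule.span_induction (p := fun s _ =>
    ambientMap f g s ∈ Submodule.span ℂ {t | ∃ a b, t = ambientTmul a b}) ?_ ?_ ?_ ?_ hs
  · rintro _ ⟨a, b, rfl⟩
    exact Submodule.subset_span ⟨f a, g b, rfl⟩
  · rw [map_zero]; exact zero_mem _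
  · intro x y _ _ h h'; rw [map_add]; exact add_mem h h'
  · intro r x _ h; rw [map_smul]; exact Submodule.smul_mem _ _ h

/-- The ⋆-homomorphism `f ⊗ g : A ⊗ B → A' ⊗ B'`. -/
def map (f : A →⋆ₙₐ[ℂ] A') (g : B →⋆ₙₐ[ℂ] B') : MinTensor.{u} A B →⋆ₙₐ[ℂ] MinTensor.{u} A' B' where
  toFun t := ⟨ambientMap f g t.1, ambientMap_mem f g t.2⟩
  map_smul' _ _ := rfl
  map_zero' := rfl
  map_add' _ _ := rfl
  map_mul' _ _ := rfl
  map_star' _ := rfl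

theorem map_tmul (f : A →⋆ₙₐ[ℂ] A') (g : B →⋆ₙₐ[ℂ] B') (a : A) (b : B) :
    map.{u} f g (tmul a b) = tmul (f a) (g b) := rfl

/-- `s ∈ (A ⊗ B) ⊗ C` and `t ∈ A ⊗ (B ⊗ C)` are the same element of `A ⊗ B ⊗ C`: under the
canonical identification of `(H ⊗ K) ⊗ L` with `H ⊗ (K ⊗ L)` they are represented by the same
operator, for any representations of `A`, `B`, `C` on `H`, `K`, `L`. As the elementary tensors
of vectors are total, it suffices to compare the matrix coefficients at these. -/
def AssocEq {C : Type v'} [NonUnitalCStarAlgebra C] (s : MinTensor.{u} (MinTensor.{u} A B) C)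
    (t : MinTensor.{u} A (MinTensor.{u} B C)) : Prop :=
  ∀ (π : HilbertRep.{u} A) (ρ : HilbertRep.{u} B) (σ : HilbertRep.{u} C)
    (ξ ξ' : π.space) (η η' : ρ.space) (ζ ζ' : σ.space),
    inner ℂ (vecTmul (vecTmul ξ η) ζ)
        ((tensorRep (tensorRep π ρ) σ).hom s (vecTmul (vecTmul ξ' η') ζ')) =
      inner ℂ (vecTmul ξ (vecTmul η ζ))
        ((tensorRep π (tensorRep ρ σ)).hom t (vecTmul ξ' (vecTmul η' ζ')))

end MinTensor

end MinTensor

/-! ### Compact quantum groups and their actions -/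

open MinTensor

/-- A compact quantum group `(A, Δ)`: a unital C⋆-algebra `A` with a unital coassociative
⋆-homomorphism `Δ : A → A ⊗ A` such that `[Δ(A)(A ⊗ 1)] = A ⊗ A = [Δ(A)(1 ⊗ A)]`. -/
structure CompactQuantumGroup (A : Type u) [CStarAlgebra A] where
  comul : A →⋆ₙₐ[ℂ] MinTensor.{u} A A
  comul_one : comul 1 = tmul 1 1
  coassoc : ∀ a, AssocEq (map comul (NonUnitalStarAlgHom.id ℂ A) (comul a))
    (map (NonUnitalStarAlgHom.id ℂ A) comul (comul a))
  cancel_left : closure (Submodule.span ℂ {t | ∃ a b, t = incl A A (comul a) * leftLeg b} :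
    Set (Ambient.{u} A A)) = Set.range (incl A A)
  cancel_right : closure (Submodule.span ℂ {t | ∃ a b, t = incl A A (comul a) * rightLeg b} :
    Set (Ambient.{u} A A)) = Set.range (incl A A)

variable {A : Type u} [CStarAlgebra A]

/-- `h` is a Haar state of the compact quantum group: a state that is left and right invariant,
`(ι ⊗ h)Δ(a) = h(a)1 = (h ⊗ ι)Δ(a)`. -/
structure CompactQuantumGroup.IsHaarState (G : CompactQuantumGroup A) (h : A →L[ℂ] ℂ) : Prop where
  nonneg : ∀ a, 0 ≤ h (star a * a)
  map_one : h 1 = 1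
  left_invariant : ∀ a, sliceRight h (G.comul a) = h a • (1 : A)
  right_invariant : ∀ a, sliceLeft h (G.comul a) = h a • (1 : A)

/-- A (continuous, left) coaction of the compact quantum group `G = (A, Δ)` on a C⋆-algebra `D`,
which makes `D` a `G`-C⋆-algebra: a ⋆-homomorphism `Δ_D : D → A ⊗ D` with
`(ι ⊗ Δ_D)Δ_D = (Δ ⊗ ι)Δ_D` and `[Δ_D(D)(A ⊗ 1)] = A ⊗ D`. As `A` is unital, a morphism
`Δ_D : D → M(A ⊗ D)` with the last property takes its values in `A ⊗ D`, and any
⋆-homomorphism with this property is nondegenerate. -/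
structure Coaction (G : CompactQuantumGroup A) (D : Type u) [NonUnitalCStarAlgebra D] where
  hom : D →⋆ₙₐ[ℂ] MinTensor.{u} A D
  coassoc : ∀ d, AssocEq (map G.comul (NonUnitalStarAlgHom.id ℂ D) (hom d))
    (map (NonUnitalStarAlgHom.id ℂ A) hom (hom d))
  density : closure (Submodule.span ℂ {t | ∃ d a, t = incl A D (hom d) * leftLeg a} :
    Set (Ambient.{u} A D)) = Set.range (incl A D)

namespace Coaction

variable {G : CompactQuantumGroup A}

/-- A coaction on a unital C⋆-algebra `X` is ergodic, i.e. makes `X` a quantum homogeneous space,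
if its fixed points `{x | Δ_X(x) = 1 ⊗ x}` are exactly the scalars. -/
def IsErgodic {X : Type u} [CStarAlgebra X] (δ : Coaction G X) : Prop :=
  {x : X | δ.hom x = tmul 1 x} = Set.range fun c : ℂ => c • (1 : X)

/-- `π` is a `G`-morphism from `D` to `B`: a ⋆-homomorphism `π : D → M(B)` which is
nondegenerate, `[π(D)B] = B`, and equivariant, `Δ_B ∘ π = (ι ⊗ π) ∘ Δ_D`.

The extension of `Δ_B` to `M(B)` is determined by `Δ_B(m) Δ_B(b) = Δ_B(m b)`, and `Δ_B(B)` is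
nondegenerate in `M(A ⊗ B)`; so equivariance says `Δ_B(π(d) b) = (ι ⊗ π)(Δ_D(d)) Δ_B(b)`. This is an
equation in `A ⊗ M(B)`, which contains `A ⊗ B` as an ideal and is contained in `M(A ⊗ B)`. -/
structure IsGMorphism {D B : Type u} [NonUnitalCStarAlgebra D] [NonUnitalCStarAlgebra B]
    (δ : Coaction G D) (β : Coaction G B) (π : D →⋆ₙₐ[ℂ] 𝓜(ℂ, B)) : Prop where
  nondegenerate : closure (Submodule.span ℂ {c | ∃ d b, c = (π d).fst b} : Set B) = Set.univ
  equivariant : ∀ d b,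
    map (NonUnitalStarAlgHom.id ℂ A) (DoubleCentralizer.coeHom (𝕜 := ℂ) (A := B))
        (β.hom ((π d).fst b)) =
      map (NonUnitalStarAlgHom.id ℂ A) π (δ.hom d) *
        map (NonUnitalStarAlgHom.id ℂ A) (DoubleCentralizer.coeHom (𝕜 := ℂ) (A := B)) (β.hom b)

/-- A `G`-C⋆-algebra `D` is `G`-simple if every `G`-morphism from `D` to a nonzero
`G`-C⋆-algebra has kernel zero. -/
def IsGSimple {D : Type u} [NonUnitalCStarAlgebra D] (δ : Coaction G D) : Prop :=
  ∀ (B : Type u) [NonUnitalCStarAlgebra B] [Nontrivial B] (β : Coaction G B)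
    (π : D →⋆ₙₐ[ℂ] 𝓜(ℂ, B)), IsGMorphism δ β π → ∀ d, π d = 0 → d = 0

end Coaction

end QuantumGroup

end

/-! Let `π` be a `G`-morphism from `X` to `B ≠ 0`, let `π d = 0` and put `y = star d * d`. The
average `(h ⊗ ι)Δ_X(y)` is a fixed point by coassociativity and invariance of the Haar state
(`Coaction.hom_average`), hence a scalar `c • 1` by ergodicity.

On the other side, `π y = 0` and equivariance give `(ι ⊗ π)(Δ_X(y)) Δ_B(b) = 0` for all `b`. Since
`[Δ_B(B)(A ⊗ 1)] = A ⊗ B`, the element `(ι ⊗ π)(Δ_X(y))` annihilates `A ⊗ B`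
(`map_mul_tmul_eq_zero`). Slicing with `h` yields `c • π(1)b = 0` for all `b`, and nondegeneracy
forces `c = 0`. Thus the positive element `Δ_X(d)⋆Δ_X(d)` has zero average. Faithfulness of `h`
makes the GNS vector `Ω` separating, so `Δ_X(d) = 0` (`eq_zero_of_separating`), and injectivity of
`Δ_X` gives `d = 0`.

Slices are handled through matrix coefficients in `π ⊗ ρ`. Bounding a slice requires that
representations determine the norm of the algebra in which it takes values (`IsNormedByReps`). For
`A` this follows from the faithful GNS representation of `h`, for `X` from injectivity of `Δ_X`. -/

namespace QuantumGroup

/-! ### Totality of elementary tensors of vectors -/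

section HilbertTensor

variable {H K : Type u}
  [NormedAddCommGroup H] [InnerProductSpace ℂ H] [NormedAddCommGroup K] [InnerProductSpace ℂ K]

theorem opTensor_vecTmul (S : H →L[ℂ] H) (T : K →L[ℂ] K) (ξ : H) (η : K) :
    opTensor S T (vecTmul ξ η) = vecTmul (S ξ) (T η) :=
  opTensor_coe S T _

theorem inner_vecTmul (ξ ξ' : H) (η η' : K) :
    inner ℂ (vecTmul ξ η) (vecTmul ξ' η') = inner ℂ ξ ξ' * inner ℂ η η' := by
  rw [vecTmul, vecTmul, UniformSpace.Completion.inner_coe, TensorProduct.inner_tmul]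

theorem norm_vecTmul (ξ : H) (η : K) : ‖vecTmul ξ η‖ = ‖ξ‖ * ‖η‖ := by
  rw [vecTmul, UniformSpace.Completion.norm_coe, TensorProduct.norm_tmul]

theorem clm_ext_vecTmul {F : Type*} [NormedAddCommGroup F] [NormedSpace ℂ F]
    {f g : HilbertTensor H K →L[ℂ] F} (h : ∀ ξ η, f (vecTmul ξ η) = g (vecTmul ξ η)) :
    f = g := by
  ext z
  induction z using UniformSpace.Completion.induction_on with
  | hp => exact isClosed_eq f.continuous g.continuous
  | ih x =>
    induction x with
    | zero => rw [UniformSpace.Completion.coe_zero, map_zero, map_zero]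
    | add x y hx hy => rw [UniformSpace.Completion.coe_add, map_add, map_add, hx, hy]
    | tmul ξ η => exact h ξ η

theorem eq_of_inner_vecTmul {z w : HilbertTensor H K}
    (h : ∀ ξ η, inner ℂ (vecTmul ξ η) z = inner ℂ (vecTmul ξ η) w) : z = w := by
  have key : innerSL ℂ z = innerSL ℂ w := clm_ext_vecTmul fun ξ η => by
    rw [innerSL_apply_apply, innerSL_apply_apply, ← inner_conj_symm, h, inner_conj_symm]
  refine ext_inner_right ℂ fun v => ?_
  simpa using DFunLike.congr_fun key v

theorem clm_ext_inner_vecTmul {f g : HilbertTensor H K →L[ℂ] HilbertTensor H K}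
    (h : ∀ ξ η ξ' η', inner ℂ (vecTmul ξ η) (f (vecTmul ξ' η')) =
      inner ℂ (vecTmul ξ η) (g (vecTmul ξ' η'))) : f = g :=
  clm_ext_vecTmul fun ξ' η' => eq_of_inner_vecTmul fun ξ η => h ξ η ξ' η'

end HilbertTensor

/-! ### GNS representations and separation of points -/

/-- The GNS representation of a positive functional, with its cyclic vector. -/
theorem exists_hilbertRep_inner_eq {A : Type u} [CStarAlgebra A] (f : A →ₗ[ℂ] ℂ)
    (hf : ∀ a, 0 ≤ f (star a * a)) :
    ∃ (π : HilbertRep.{u} A) (Ω : π.space), π.hom 1 Ω = Ω ∧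
      ∀ a, inner ℂ Ω (π.hom a Ω) = f a := by
  let _ := CStarAlgebra.spectralOrder A
  have := CStarAlgebra.spectralOrderedRing A
  have hpos : ∀ a, 0 ≤ a → 0 ≤ f a := fun a ha => by
    obtain ⟨b, rfl⟩ := CStarAlgebra.nonneg_iff_eq_star_mul_self.mp ha
    exact hf b
  let φ : A →ₚ[ℂ] ℂ :=
    { f with
      monotone' := fun a b hab => sub_nonneg.mp
        ((hpos (b - a) (sub_nonneg.mpr hab)).trans_eq (map_sub f b a)) }
  refine ⟨⟨φ.GNS, φ.gnsNonUnitalStarAlgHom⟩, ((φ.toPreGNS 1 : φ.PreGNS) : φ.GNS), ?_, fun a => ?_⟩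
  · simp
  · simp only [PositiveLinearMap.gnsNonUnitalStarAlgHom_apply_coe,
      UniformSpace.Completion.inner_coe]
    simp [PositiveLinearMap.preGNS_inner_def]
    rfl

theorem HilbertRep.inner_apply_apply {A : Type v} [NonUnitalCStarAlgebra A] (π : HilbertRep.{u} A)
    (a : A) (ξ η : π.space) :
    inner ℂ (π.hom a ξ) (π.hom a η) = inner ℂ ξ (π.hom (star a * a) η) := by
  rw [map_mul, map_star, ContinuousLinearMap.star_eq_adjoint, mul_apply_eq_comp,
    ContinuousLinearMap.adjoint_inner_right]

/-- A positive functional that does not vanish on `star m * m`. -/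
theorem exists_positive_functional_ne_zero {M : Type u} [CStarAlgebra M] {m : M} (hm : m ≠ 0) :
    ∃ f : M →ₗ[ℂ] ℂ, (∀ a, 0 ≤ f (star a * a)) ∧ f (star m * m) ≠ 0 := by
  let _ := CStarAlgebra.spectralOrder M
  have := CStarAlgebra.spectralOrderedRing M
  let C : ProperCone ℝ M :=
    { carrier := {a | 0 ≤ a}
      add_mem' := fun {a b} (ha : 0 ≤ a) (hb : 0 ≤ b) => show 0 ≤ a + b from add_nonneg ha hb
      zero_mem' := le_refl (0 : M)
      smul_mem' := fun c a (ha : 0 ≤ a) => show 0 ≤ (c : ℝ) • a from smul_nonneg c.2 ha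
      isClosed' := CStarAlgebra.isClosed_nonneg }
  have hy : -(star m * m) ∉ C := fun hmem => by
    have h1 : (0 : M) ≤ -(star m * m) := hmem
    have h2 : star m * m = 0 := le_antisymm (neg_nonneg.mp h1) (star_mul_self_nonneg m)
    exact hm (CStarRing.star_mul_self_eq_zero_iff m |>.mp h2)
  obtain ⟨g, hg, hgm⟩ := C.hyperplane_separation_point hy
  -- Symmetrizing the separating functional `g` makes it vanish on skew-adjoint elements, so that
  -- its complexification is real on each `star a * a`, with value `2 * g (star a * a)`.
  let k : M →ₗ[ℝ] ℝ :=
    { toFun := fun a => g (a + star a)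
      map_add' := fun a b => by rw [star_add, add_add_add_comm, map_add]
      map_smul' := fun c a => by
        rw [star_smul, star_trivial, ← smul_add, map_smul]; rfl }
  have hk : ∀ a, Module.Dual.extendRCLike (𝕜 := ℂ) k (star a * a) =
      ((2 * g (star a * a) : ℝ) : ℂ) := fun a => by
    have h1 : k (star a * a) = 2 * g (star a * a) := by
      change g (_ + star _) = _
      rw [star_mul, star_star, ← two_smul ℝ, map_smul]; rfl
    have h2 : k (Complex.I • (star a * a)) = 0 := by
      change g (_ + star _) = _
      rw [star_smul, star_mul, star_star]
      simp
    rw [Module.Dual.extendRCLike_apply, h1]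
    simp [h2]
  refine ⟨Module.Dual.extendRCLike k, fun a => ?_, ?_⟩
  · rw [hk]
    exact_mod_cast mul_nonneg zero_le_two (hg _ (show (0 : M) ≤ _ from star_mul_self_nonneg a))
  · rw [hk]
    rw [map_neg] at hgm
    exact_mod_cast (by linarith : (0 : ℝ) < 2 * g (star m * m)).ne'

/-- Representations separate the points of a unital C⋆-algebra. -/
theorem eq_zero_of_forall_hilbertRep {M : Type u} [CStarAlgebra M] {m : M}
    (h : ∀ σ : HilbertRep.{u} M, σ.hom m = 0) : m = 0 := by
  by_contra hm
  obtain ⟨f, hf, hfm⟩ := exists_positive_functional_ne_zero hm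
  obtain ⟨σ, Ω, -, hΩ⟩ := exists_hilbertRep_inner_eq f hf
  refine hfm ?_
  rw [← hΩ, ← σ.inner_apply_apply, h σ]
  simp

/-! ### Vector functionals and norms determined by representations -/

/-- The norm of `B` is the supremum of the operator norms in its representations. -/
def IsNormedByReps (B : Type v) [NonUnitalCStarAlgebra B] : Prop :=
  ∀ (b : B) (C : ℝ), 0 ≤ C → (∀ ρ : HilbertRep.{u} B, ‖ρ.hom b‖ ≤ C) → ‖b‖ ≤ C

theorem IsNormedByReps.of_injective {B : Type v} [NonUnitalCStarAlgebra B] (ρ : HilbertRep.{u} B)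
    (hρ : Function.Injective ρ.hom) : IsNormedByReps.{u} B := fun b _ _ h =>
  (NonUnitalStarAlgHom.norm_map ρ.hom hρ b).symm.trans_le (h ρ)

/-- The vector functional `b ↦ ⟪η, ρ(b) η'⟫`. -/
noncomputable def vectorFunctional {B : Type v} [NonUnitalCStarAlgebra B] (ρ : HilbertRep.{u} B)
    (η η' : ρ.space) : B →L[ℂ] ℂ :=
  LinearMap.mkContinuous
    { toFun := fun b => inner ℂ η (ρ.hom b η')
      map_add' := fun _ _ => by simp only [map_add, add_apply, inner_add_right]
      map_smul' := fun _ _ => by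
        simp only [map_smul, smul_apply, inner_smul_right, RingHom.id_apply, smul_eq_mul] }
    (‖η‖ * ‖η'‖) fun b => by
      refine (norm_inner_le_norm _ _).trans ?_
      rw [mul_assoc, mul_comm ‖η'‖]
      refine mul_le_mul_of_nonneg_left ((ContinuousLinearMap.le_opNorm _ _).trans ?_)
        (norm_nonneg _)
      exact mul_le_mul_of_nonneg_right (NonUnitalStarAlgHom.norm_apply_le ρ.hom b) (norm_nonneg _)

theorem vectorFunctional_apply {B : Type v} [NonUnitalCStarAlgebra B] (ρ : HilbertRep.{u} B)
    (η η' : ρ.space) (b : B) : vectorFunctional ρ η η' b = inner ℂ η (ρ.hom b η') := rfl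

theorem vectorFunctional_mul {B : Type v} [NonUnitalCStarAlgebra B] (ρ : HilbertRep.{u} B)
    (η η' : ρ.space) (b c : B) :
    vectorFunctional ρ η η' (b * c) = vectorFunctional ρ η (ρ.hom c η') b := by
  rw [vectorFunctional_apply, vectorFunctional_apply, map_mul, mul_apply_eq_comp]

/-- The hypothesis says `‖ρ(b)η'‖² = 0`. -/
theorem vectorFunctional_eq_zero_of_star_mul_self {B : Type v} [NonUnitalCStarAlgebra B]
    (ρ : HilbertRep.{u} B) {b : B} (η' : ρ.space)
    (h : vectorFunctional ρ η' η' (star b * b) = 0) (η : ρ.space) :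
    vectorFunctional ρ η η' b = 0 := by
  rw [vectorFunctional_apply, ← ρ.inner_apply_apply, inner_self_eq_zero] at h
  rw [vectorFunctional_apply, h, inner_zero_right]

theorem norm_vectorFunctional_apply_le {B : Type v} [NonUnitalCStarAlgebra B]
    (ρ : HilbertRep.{u} B) (η η' : ρ.space) (b : B) :
    ‖vectorFunctional ρ η η' b‖ ≤ ‖η‖ * ‖η'‖ * ‖b‖ :=
  (ContinuousLinearMap.le_opNorm _ _).trans <| mul_le_mul_of_nonneg_right
    (LinearMap.mkContinuous_norm_le _ (by positivity) _) (norm_nonneg _)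

theorem opNorm_le_of_norm_inner_le {H : Type*} [NormedAddCommGroup H] [InnerProductSpace ℂ H]
    {T : H →L[ℂ] H} {C : ℝ} (hC : 0 ≤ C)
    (h : ∀ η η', ‖η‖ = 1 → ‖η'‖ = 1 → ‖inner ℂ η (T η')‖ ≤ C) : ‖T‖ ≤ C := by
  refine ContinuousLinearMap.opNorm_le_of_re_inner_le (𝕜 := ℂ) hC fun x y hx hy => ?_
  refine (RCLike.re_le_norm _).trans ?_
  rw [norm_inner_symm]
  exact h y x hy hx

theorem IsNormedByReps.norm_le {B : Type v} [NonUnitalCStarAlgebra B] (hB : IsNormedByReps.{u} B)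
    {b : B} {C : ℝ} (hC : 0 ≤ C) (h : ∀ (ρ : HilbertRep.{u} B) (η η' : ρ.space), ‖η‖ = 1 →
      ‖η'‖ = 1 → ‖vectorFunctional ρ η η' b‖ ≤ C) : ‖b‖ ≤ C :=
  hB b C hC fun ρ => opNorm_le_of_norm_inner_le hC (h ρ)

/-! ### Matrix coefficients and slices on the minimal tensor product -/

namespace MinTensor

variable {A : Type v} {B : Type w} [NonUnitalCStarAlgebra A] [NonUnitalCStarAlgebra B]

theorem ext_tensorRep {s t : MinTensor.{u} A B}
    (h : ∀ (π : HilbertRep.{u} A) (ρ : HilbertRep.{u} B),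
      (tensorRep π ρ).hom s = (tensorRep π ρ).hom t) : s = t :=
  Subtype.ext (ambient_ext fun i => h i.1 i.2)

theorem ofAlg_tmul (a : A) (b : B) : ofAlg.{u} A B (a ⊗ₜ b) = tmul a b := rfl

theorem denseRange_ofAlg : DenseRange (ofAlg.{u} A B) := by
  intro t
  refine closure_subtype.mpr (closure_mono ?_ t.2)
  intro s hs
  refine Submodule.span_induction (p := fun s _ => s ∈ Subtype.val '' Set.range (ofAlg.{u} A B))
    ?_ ?_ ?_ ?_ hs
  · rintro _ ⟨a, b, rfl⟩
    exact ⟨_, ⟨a ⊗ₜ b, rfl⟩, rfl⟩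
  · exact ⟨_, ⟨0, rfl⟩, congrArg Subtype.val (map_zero (ofAlg.{u} A B))⟩
  · rintro _ _ _ _ ⟨_, ⟨x, rfl⟩, rfl⟩ ⟨_, ⟨y, rfl⟩, rfl⟩
    exact ⟨_, ⟨x + y, rfl⟩, congrArg Subtype.val (map_add (ofAlg.{u} A B) x y)⟩
  · rintro c _ _ ⟨_, ⟨x, rfl⟩, rfl⟩
    exact ⟨_, ⟨c • x, rfl⟩, congrArg Subtype.val (map_smul (ofAlg.{u} A B) c x)⟩

/-- Continuous linear maps on `A ⊗ B` agree if they agree on elementary tensors. -/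
theorem clm_ext {F : Type*} [NormedAddCommGroup F] [NormedSpace ℂ F]
    {f g : MinTensor.{u} A B →L[ℂ] F} (h : ∀ a b, f (tmul a b) = g (tmul a b)) : f = g := by
  ext t
  refine denseRange_ofAlg.induction_on t (isClosed_eq f.continuous g.continuous) fun z => ?_
  induction z with
  | zero => rw [map_zero, map_zero, map_zero]
  | add x y hx hy => rw [map_add, map_add, map_add, hx, hy]
  | tmul a b => exact h a b

/-- The matrix coefficient `t ↦ ⟪ξ ⊗ η, (π ⊗ ρ)(t) (ξ' ⊗ η')⟫`. -/
noncomputable def coeff (π : HilbertRep.{u} A) (ρ : HilbertRep.{u} B) (ξ ξ' : π.space)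
    (η η' : ρ.space) : MinTensor.{u} A B →L[ℂ] ℂ :=
  vectorFunctional (tensorRep π ρ) (vecTmul ξ η) (vecTmul ξ' η')

theorem coeff_tmul (π : HilbertRep.{u} A) (ρ : HilbertRep.{u} B) (ξ ξ' : π.space)
    (η η' : ρ.space) (a : A) (b : B) :
    coeff π ρ ξ ξ' η η' (tmul a b) =
      vectorFunctional π ξ ξ' a * vectorFunctional ρ η η' b := by
  change inner ℂ (vecTmul ξ η) (opTensor (π.hom a) (ρ.hom b) (vecTmul ξ' η')) = _
  rw [opTensor_vecTmul, inner_vecTmul]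
  rfl

theorem coeff_mul_tmul (π : HilbertRep.{u} A) (ρ : HilbertRep.{u} B) (ξ ξ' : π.space)
    (η η' : ρ.space) (t : MinTensor.{u} A B) (a : A) (b : B) :
    coeff π ρ ξ ξ' η η' (t * tmul a b) =
      coeff π ρ ξ (π.hom a ξ') η (ρ.hom b η') t :=
  (vectorFunctional_mul (tensorRep π ρ) (vecTmul ξ η) (vecTmul ξ' η') t (tmul a b)).trans <|
    congrArg (fun ζ => vectorFunctional (tensorRep π ρ) (vecTmul ξ η) ζ t)
      (opTensor_vecTmul (π.hom a) (ρ.hom b) ξ' η')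

theorem norm_coeff_le (π : HilbertRep.{u} A) (ρ : HilbertRep.{u} B) (ξ ξ' : π.space)
    (η η' : ρ.space) (t : MinTensor.{u} A B) :
    ‖coeff π ρ ξ ξ' η η' t‖ ≤ ‖ξ‖ * ‖η‖ * (‖ξ'‖ * ‖η'‖) * ‖t‖ := by
  have h := norm_vectorFunctional_apply_le (tensorRep π ρ) (vecTmul ξ η) (vecTmul ξ' η') t
  exact h.trans_eq (congrArg (· * ‖t‖) (congrArg₂ (· * ·) (norm_vecTmul ξ η) (norm_vecTmul ξ' η')))

theorem ext_coeff {s t : MinTensor.{u} A B}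
    (h : ∀ (π : HilbertRep.{u} A) (ρ : HilbertRep.{u} B) (ξ ξ' : π.space) (η η' : ρ.space),
      coeff π ρ ξ ξ' η η' s = coeff π ρ ξ ξ' η η' t) : s = t :=
  ext_tensorRep fun π ρ => clm_ext_inner_vecTmul fun ξ η ξ' η' => h π ρ ξ ξ' η η'

theorem coeff_ofAlg_left (π : HilbertRep.{u} A) (ρ : HilbertRep.{u} B) (ξ ξ' : π.space)
    (η η' : ρ.space) (z : A ⊗[ℂ] B) :
    coeff π ρ ξ ξ' η η' (ofAlg A B z) = vectorFunctional ρ η η' ((TensorProduct.lid ℂ B).toLinearMap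
      (TensorProduct.map (vectorFunctional π ξ ξ').toLinearMap (LinearMap.id : B →ₗ[ℂ] B) z)) := by
  induction z with
  | zero => simp
  | add x y hx hy => simp only [map_add, hx, hy]
  | tmul a b => rw [ofAlg_tmul, coeff_tmul]; simp

theorem coeff_ofAlg_right (π : HilbertRep.{u} A) (ρ : HilbertRep.{u} B) (ξ ξ' : π.space)
    (η η' : ρ.space) (z : A ⊗[ℂ] B) :
    coeff π ρ ξ ξ' η η' (ofAlg A B z) = vectorFunctional π ξ ξ' ((TensorProduct.rid ℂ A).toLinearMap
      (TensorProduct.map (LinearMap.id : A →ₗ[ℂ] A) (vectorFunctional ρ η η').toLinearMap z)) := by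
  induction z with
  | zero => simp
  | add x y hx hy => simp only [map_add, hx, hy]
  | tmul a b => rw [ofAlg_tmul, coeff_tmul]; simp [mul_comm]

/-- The extension defining the slice is computed by this formula only once the algebraic slice is
known to be bounded. Its vector functionals are matrix coefficients of `π ⊗ ρ`, bounded by `‖ξ‖ *
‖ξ'‖` times the norm of the tensor; `hB` turns this into a norm bound in `B`. -/
theorem sliceLeft_tmul (hB : IsNormedByReps.{u} B) (π : HilbertRep.{u} A) (ξ ξ' : π.space)
    (a : A) (b : B) :
    sliceLeft (vectorFunctional π ξ ξ') (tmul.{u} a b) = vectorFunctional π ξ ξ' a • b := by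
  rw [sliceLeft, ← ofAlg_tmul, LinearMap.extendOfNorm_eq denseRange_ofAlg
    ⟨‖ξ‖ * ‖ξ'‖, fun z => hB.norm_le (by positivity) fun ρ η η' hη hη' => ?_⟩]
  · simp
  · refine (congrArg norm (coeff_ofAlg_left π ρ ξ ξ' η η' z)).symm.trans_le ?_
    simpa [hη, hη'] using norm_coeff_le π ρ ξ ξ' η η' (ofAlg A B z)

theorem sliceRight_tmul (hA : IsNormedByReps.{u} A) (ρ : HilbertRep.{u} B) (η η' : ρ.space)
    (a : A) (b : B) :
    sliceRight (vectorFunctional ρ η η') (tmul.{u} a b) = vectorFunctional ρ η η' b • a := by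
  rw [sliceRight, ← ofAlg_tmul, LinearMap.extendOfNorm_eq denseRange_ofAlg
    ⟨‖η‖ * ‖η'‖, fun z => hA.norm_le (by positivity) fun π ξ ξ' hξ hξ' => ?_⟩]
  · simp
  · refine (congrArg norm (coeff_ofAlg_right π ρ ξ ξ' η η' z)).symm.trans_le ?_
    simpa [hξ, hξ'] using norm_coeff_le π ρ ξ ξ' η η' (ofAlg A B z)

theorem coeff_eq_sliceLeft (hB : IsNormedByReps.{u} B) (π : HilbertRep.{u} A)
    (ρ : HilbertRep.{u} B) (ξ ξ' : π.space) (η η' : ρ.space) (t : MinTensor.{u} A B) :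
    coeff π ρ ξ ξ' η η' t =
      vectorFunctional ρ η η' (sliceLeft (vectorFunctional π ξ ξ') t) := by
  have h : coeff π ρ ξ ξ' η η' =
      (vectorFunctional ρ η η').comp (sliceLeft (vectorFunctional π ξ ξ')) :=
    clm_ext fun a b => by
      rw [coeff_tmul, ContinuousLinearMap.comp_apply, sliceLeft_tmul hB, map_smul, smul_eq_mul]
  exact DFunLike.congr_fun h t

theorem coeff_eq_sliceRight (hA : IsNormedByReps.{u} A) (π : HilbertRep.{u} A)
    (ρ : HilbertRep.{u} B) (ξ ξ' : π.space) (η η' : ρ.space) (t : MinTensor.{u} A B) :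
    coeff π ρ ξ ξ' η η' t =
      vectorFunctional π ξ ξ' (sliceRight (vectorFunctional ρ η η') t) := by
  have h : coeff π ρ ξ ξ' η η' =
      (vectorFunctional π ξ ξ').comp (sliceRight (vectorFunctional ρ η η')) :=
    clm_ext fun a b => by
      rw [coeff_tmul, ContinuousLinearMap.comp_apply, sliceRight_tmul hA, map_smul, smul_eq_mul,
        mul_comm]
  exact DFunLike.congr_fun h t

/-- If `Ω` is separating for `π`, an element of `A ⊗ B` that kills `Ω ⊗ η` in all the
representations `π ⊗ ρ` is zero. -/
theorem eq_zero_of_separating (hA : IsNormedByReps.{u} A) (π : HilbertRep.{u} A) (Ω : π.space)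
    (hΩ : ∀ a, π.hom a Ω = 0 → a = 0) (s : MinTensor.{u} A B)
    (hs : ∀ (ρ : HilbertRep.{u} B) (ξ : π.space) (η η' : ρ.space), coeff π ρ ξ Ω η η' s = 0) :
    s = 0 := by
  refine ext_coeff fun π' ρ ξ ξ' η η' => ?_
  -- The slice is an element `a` of `A` with `π(a)Ω = 0`; once it vanishes, so do the coefficients
  -- in every other representation `π'`.
  have h0 : sliceRight (vectorFunctional ρ η η') s = 0 := hΩ _ <| ext_inner_left ℂ fun v => by
    rw [← vectorFunctional_apply, ← coeff_eq_sliceRight hA, hs, inner_zero_right]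
  rw [coeff_eq_sliceRight hA, h0, map_zero, map_zero]

end MinTensor

/-! ### Averaging over the Haar state and simplicity -/

open MinTensor

variable {A : Type u} [CStarAlgebra A] {G : CompactQuantumGroup A}

/-- If the coaction is injective, representations determine the norm. -/
theorem Coaction.isNormedByReps {X : Type u} [NonUnitalCStarAlgebra X] (δ : Coaction G X)
    (hδ : Function.Injective δ.hom) : IsNormedByReps.{u} X := fun x C hC h => by
  rw [← NonUnitalStarAlgHom.norm_map δ.hom hδ x]
  -- The norm of `Δ_X(x)` is a supremum over operators `(π ⊗ ρ)(Δ_X(x))`, and each `(π ⊗ ρ) ∘ Δ_X`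
  -- is itself a representation of `X`.
  exact lp.norm_le_of_forall_le hC fun i => h ((tensorRep i.1 i.2).comp δ.hom)

/-- The average `(h ⊗ ι)Δ_X(x)` over the Haar state `h` is a fixed point. -/
theorem Coaction.hom_average {X : Type u} [NonUnitalCStarAlgebra X] (δ : Coaction G X)
    (hA : IsNormedByReps.{u} A) (hX : IsNormedByReps.{u} X) (πh : HilbertRep.{u} A)
    (Ω : πh.space) (hG : G.IsHaarState (vectorFunctional πh Ω Ω)) (x : X) :
    δ.hom (sliceLeft (vectorFunctional πh Ω Ω) (δ.hom x)) =
      tmul 1 (sliceLeft (vectorFunctional πh Ω Ω) (δ.hom x)) := by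
  refine ext_coeff fun π ρ ξ ξ' η η' => ?_
  have h₁ : coeff π ρ ξ ξ' η η' (δ.hom (sliceLeft (vectorFunctional πh Ω Ω) (δ.hom x))) =
      coeff πh ((tensorRep π ρ).comp δ.hom) Ω Ω (vecTmul ξ η) (vecTmul ξ' η') (δ.hom x) :=
    (coeff_eq_sliceLeft hX πh ((tensorRep π ρ).comp δ.hom) Ω Ω (vecTmul ξ η) (vecTmul ξ' η')
      (δ.hom x)).symm
  -- Coassociativity, read as an equality of coefficients of `Δ_X(x)` by absorbing the inner
  -- coproduct or coaction into the representation.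
  have h₂ : coeff ((tensorRep πh π).comp G.comul) ρ (vecTmul Ω ξ) (vecTmul Ω ξ') η η' (δ.hom x) =
      coeff πh ((tensorRep π ρ).comp δ.hom) Ω Ω (vecTmul ξ η) (vecTmul ξ' η') (δ.hom x) :=
    δ.coassoc x πh π ρ Ω Ω ξ ξ' η η'
  -- Invariance `(h ⊗ ι)Δ(a) = h(a)1` decouples the middle leg on elementary tensors.
  have h₃ : coeff ((tensorRep πh π).comp G.comul) ρ (vecTmul Ω ξ) (vecTmul Ω ξ') η η' =
      vectorFunctional π ξ ξ' 1 •
        (vectorFunctional ρ η η').comp (sliceLeft (vectorFunctional πh Ω Ω)) :=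
    clm_ext fun a y => by
      have h₄ : vectorFunctional ((tensorRep πh π).comp G.comul) (vecTmul Ω ξ) (vecTmul Ω ξ') a =
          vectorFunctional π ξ ξ' (sliceLeft (vectorFunctional πh Ω Ω) (G.comul a)) :=
        coeff_eq_sliceLeft hA πh π Ω Ω ξ ξ' (G.comul a)
      refine (coeff_tmul ((tensorRep πh π).comp G.comul) ρ (vecTmul Ω ξ) (vecTmul Ω ξ') η η'
        a y).trans ?_
      rw [h₄, hG.right_invariant, smul_apply, ContinuousLinearMap.comp_apply, sliceLeft_tmul hX,
        map_smul, map_smul, smul_eq_mul, smul_eq_mul, smul_eq_mul]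
      ring
  rw [h₁, ← h₂, h₃, coeff_tmul]
  rfl

/-- If `π(y) = 0`, then `(ι ⊗ π)(Δ_D(y))` annihilates `A ⊗ B`. -/
theorem Coaction.IsGMorphism.map_mul_tmul_eq_zero {D B : Type u} [NonUnitalCStarAlgebra D]
    [NonUnitalCStarAlgebra B] {δ : Coaction G D} {β : Coaction G B} {π : D →⋆ₙₐ[ℂ] 𝓜(ℂ, B)}
    (hπ : IsGMorphism δ β π) {y : D} (hy : π y = 0) (a : A) (b : B) :
    MinTensor.map (NonUnitalStarAlgHom.id ℂ A) π (δ.hom y) *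
      tmul a (DoubleCentralizer.coeHom (𝕜 := ℂ) (A := B) b) = 0 := by
  let J : Ambient.{u} A B →⋆ₙₐ[ℂ] Ambient.{u} A 𝓜(ℂ, B) :=
    ambientMap (NonUnitalStarAlgHom.id ℂ A) (DoubleCentralizer.coeHom (𝕜 := ℂ) (A := B))
  let T := incl A 𝓜(ℂ, B) (MinTensor.map (NonUnitalStarAlgHom.id ℂ A) π (δ.hom y))
  have hJ : Continuous J := AddMonoidHomClass.continuous_of_bound _ 1 fun x => by
    simpa using NonUnitalStarAlgHom.norm_apply_le J x
  have h₁ : ∀ b, T * J (incl A B (β.hom b)) = 0 := fun b => by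
    have h := hπ.equivariant y b
    rw [hy, DoubleCentralizer.zero_fst, zero_apply, map_zero, map_zero] at h
    exact (map_mul (incl A 𝓜(ℂ, B)) _ _).symm.trans
      ((congrArg (incl A 𝓜(ℂ, B)) h.symm).trans (map_zero _))
  -- The relation survives right multiplication by `A ⊗ 1`, linear combinations and limits, so the
  -- density condition extends it to all of `A ⊗ B`.
  have h₂ : closure (Submodule.span ℂ {t | ∃ d a, t = incl A B (β.hom d) * leftLeg a} :
      Set (Ambient.{u} A B)) ⊆ {z | T * J z = 0} := by
    refine closure_minimal (fun z hz => ?_) (isClosed_eq (by fun_prop) continuous_const)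
    refine Submodule.span_induction (p := fun z _ => T * J z = 0) ?_ ?_ ?_ ?_ hz
    · rintro _ ⟨d, a, rfl⟩
      rw [map_mul, ← mul_assoc, h₁, zero_mul]
    · rw [map_zero, mul_zero]
    · intro z w _ _ hz hw
      rw [map_add, mul_add, hz, hw, add_zero]
    · intro c z _ hz
      rw [map_smul, mul_smul_comm, hz, smul_zero]
  rw [β.density] at h₂
  exact Subtype.ext (h₂ ⟨tmul a b, rfl⟩)

theorem Coaction.IsGMorphism.exists_map_one_mul_ne_zero {D B : Type u} [CStarAlgebra D]
    [NonUnitalCStarAlgebra B] [Nontrivial B] {δ : Coaction G D} {β : Coaction G B}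
    {π : D →⋆ₙₐ[ℂ] 𝓜(ℂ, B)} (hπ : IsGMorphism δ β π) :
    ∃ b, π 1 * DoubleCentralizer.coeHom (𝕜 := ℂ) (A := B) b ≠ 0 := by
  by_contra! h
  have h₁ : ∀ b, (π 1).fst b = 0 := fun b => by
    -- With `w = π(1)b`, taking `x = star w` and `c = star (star w * w)` makes the C⋆-identity, used
    -- twice, give `w = 0`.
    have h₄ : ∀ x c, x * (π 1).fst b * c = 0 := fun x c => by
      have h₅ : (π 1).fst (b * c) = 0 :=
        congrArg (fun m : 𝓜(ℂ, B) => m.fst c) (h b)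
      rw [← (π 1).central, mul_assoc, (π 1).central, h₅, mul_zero]
    exact (CStarRing.star_mul_self_eq_zero_iff _).mp
      ((CStarRing.mul_star_self_eq_zero_iff _).mp (h₄ _ _))
  have h₂ : {c | ∃ d b, c = (π d).fst b} ⊆ {(0 : B)} := by
    rintro _ ⟨d, b, rfl⟩
    rw [Set.mem_singleton_iff, ← mul_one d, map_mul, DoubleCentralizer.mul_fst,
      mul_apply_eq_comp, h₁, map_zero]
  have h₃ := hπ.nondegenerate
  rw [(Submodule.span_eq_bot.mpr fun c hc => h₂ hc), Submodule.bot_coe, closure_singleton] at h₃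
  obtain ⟨b, hb⟩ := exists_ne (0 : B)
  exact hb (h₃.symm.subset (Set.mem_univ b))

theorem Coaction.isGSimple_of_isErgodic {X : Type u} [CStarAlgebra X] (δ : Coaction G X)
    (hδ : Function.Injective δ.hom) (hergodic : δ.IsErgodic) (hA : IsNormedByReps.{u} A)
    (πh : HilbertRep.{u} A) (Ω : πh.space) (h1 : πh.hom 1 Ω = Ω)
    (hsep : ∀ a, πh.hom a Ω = 0 → a = 0) (hG : G.IsHaarState (vectorFunctional πh Ω Ω)) :
    δ.IsGSimple := by
  intro B _ _ β π hπ d hd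
  have hX := δ.isNormedByReps hδ
  obtain ⟨c, hc⟩ : ∃ c : ℂ,
      c • (1 : X) = sliceLeft (vectorFunctional πh Ω Ω) (δ.hom (star d * d)) :=
    hergodic.subset (δ.hom_average hA hX πh Ω hG (star d * d))
  have hy : π (star d * d) = 0 := by rw [map_mul, hd, mul_zero]
  have hc0 : c = 0 := by
    obtain ⟨b, hb⟩ := hπ.exists_map_one_mul_ne_zero
    by_contra hne
    refine hb (eq_zero_of_forall_hilbertRep fun σ => ?_)
    ext ζ'
    refine ext_inner_left ℂ fun ζ => ?_
    let b' := DoubleCentralizer.coeHom (𝕜 := ℂ) (A := B) b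
    -- The annihilation of `1 ⊗ b` is tested at `Ω ⊗ ζ` and `Ω ⊗ ζ'`; `h1` keeps `Ω` fixed under the
    -- first leg.
    have h₁ : coeff πh (σ.comp π) Ω Ω ζ (σ.hom b' ζ') (δ.hom (star d * d)) = 0 := by
      have h₂ := coeff_mul_tmul πh σ Ω Ω ζ ζ'
        (MinTensor.map (NonUnitalStarAlgHom.id ℂ A) π (δ.hom (star d * d))) 1 b'
      rw [hπ.map_mul_tmul_eq_zero hy, map_zero, h1] at h₂
      exact h₂.symm
    -- The slice is `c • 1`, so the coefficient equals `c` times `⟪ζ, σ(π 1) σ(b') ζ'⟫`.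
    rw [coeff_eq_sliceLeft hX, ← hc, map_smul, smul_eq_mul] at h₁
    have h₅ := (mul_eq_zero.mp h₁).resolve_left hne
    rw [map_mul]
    exact h₅.trans (inner_zero_right _).symm
  have hzero : δ.hom d = 0 := by
    refine eq_zero_of_separating hA πh Ω hsep _ fun ρ ξ η η' => ?_
    -- It suffices that `‖Δ_X(d)(Ω ⊗ η')‖² = 0`; this is a diagonal coefficient of the vanishing
    -- average of `star d * d`.
    refine vectorFunctional_eq_zero_of_star_mul_self (tensorRep πh ρ) _ ?_ _
    have h₁ : coeff πh ρ Ω Ω η' η' (δ.hom (star d * d)) = 0 := by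
      rw [coeff_eq_sliceLeft hX, ← hc, hc0, zero_smul, map_zero]
    rwa [map_mul, map_star] at h₁
  exact hδ (hzero.trans (map_zero _).symm)

end QuantumGroup

theorem mainTheorem6 {A : Type u} [CStarAlgebra A] (G : QuantumGroup.CompactQuantumGroup A)
    (h : A →L[ℂ] ℂ) (hG : G.IsHaarState h) (hfaithful : ∀ a, h (star a * a) = 0 → a = 0)
    {X : Type u} [CStarAlgebra X] (δ : QuantumGroup.Coaction G X)
    (hergodic : δ.IsErgodic) (hinjective : Function.Injective δ.hom) :
    δ.IsGSimple := by
  obtain ⟨πh, Ω, h1, hΩ⟩ := QuantumGroup.exists_hilbertRep_inner_eq h.toLinearMap hG.nonneg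
  -- Replacing `h` by the vector state at `Ω` turns slices by `h` into matrix coefficients.
  obtain rfl : QuantumGroup.vectorFunctional πh Ω Ω = h := by
    ext a
    exact hΩ a
  have hsep : ∀ a, πh.hom a Ω = 0 → a = 0 := fun a ha => hfaithful a <| by
    rw [QuantumGroup.vectorFunctional_apply, ← πh.inner_apply_apply, ha, inner_zero_right]
  have hinj : Function.Injective πh.hom := (injective_iff_map_eq_zero πh.hom).mpr fun a ha =>
    hsep a (by rw [ha, zero_apply])
  exact δ.isGSimple_of_isErgodic hinjective hergodic (.of_injective πh hinj) πh Ω h1 hsep hG
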